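/- Let $\mathbb K$ be a field of characteristic zero. Compositions are written from left to right ($f\,;g$ means first $f$, then $g$). **The category.** $\mathsf{DY}^1$ is the $\mathbb K$-linear strict symmetric monoidal category whose objects are the finite sequences in two colours $[1]$ and $[V_1]$ (tensor product = concatenation, $[n]=[1]^{\otimes n}$), generated by morphisms $\mu:[2]\to[1]$, $\delta:[1]\to[2]$, $\pi:[1]\otimes[V_1]\to[V_1]$, $\pi^*:[V_1]\to[1]\otimes[V_1]$ subject to the following relations, where $\tau$ is the flip of $[2]$, $\sigma$ is a cyclic permutation of $[3]$ and $v=[V_1]$: * (Lie bialgebra) $(\mathrm{id}+\tau);\mu=0$; $\ (\mathrm{id}+\sigma+\sigma^2);(\mu\otimes\mathrm{id});\mu=0$; $\ \delta;(\mathrm{id}+\tau)=0$; $\ \delta;(\delta\otimes\mathrm{id});(\mathrm{id}+\sigma+\sigma^2)=0$; $\ \mu;\delta=(\mathrm{id}-\tau);(\delta\otimes\mathrm{id});(\mathrm{id}\otimes\mu);(\mathrm{id}-\tau)$. * (action) $(\mu\otimes\mathrm{id}_v);\pi=(\mathrm{id}\otimes\pi);\pi-(\tau\otimes\mathrm{id}_v);(\mathrm{id}\otimes\pi);\pi$.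 * (coaction) $\pi^*;(\delta\otimes\mathrm{id}_v)=\pi^*;(\mathrm{id}\otimes\pi^*);(\tau\otimes\mathrm{id}_v)-\pi^*;(\mathrm{id}\otimes\pi^*)$. * (Drinfeld–Yetter relation) $\pi;\pi^*=(\mathrm{id}\otimes\pi^*);\big((\tau\otimes\mathrm{id}_v);(\mathrm{id}\otimes\pi)+\mu\otimes\mathrm{id}_v\big)-(\delta\otimes\mathrm{id}_v);(\mathrm{id}\otimes\pi)$. The iterated action $\pi^{(n)}:[n]\otimes[V_1]\to[V_1]$ and coaction $\pi^{*(m)}:[V_1]\to[m]\otimes[V_1]$ are given by $\pi^{(0)}=\pi^{*(0)}=\mathrm{id}$, $\pi^{(n+1)}=(\mathrm{id}_{[1]}\otimes\pi^{(n)});\pi$ and $\pi^{*(m+1)}=\pi^*;(\mathrm{id}_{[1]}\otimes\pi^{*(m)})$. **Mosaics.** There are six square tiles, whose red line joins the following sides: *permutation* (all four sides, as a crossing of a horizontal and a vertical line), *bracket* (left, bottom, top), *cobracket* (left, top, right), *action* (left, right), *coaction* (bottom, top), *empty* (none). For $n,m\ge 0$ a Drinfeld–Yetter mosaic $M\in\mathfrak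 M_{n,m}$ is a filling of the grid with $n$ rows and $m$ columns by tiles such that no tile of the first row is an action or empty tile, no tile of the first column is a coaction or empty tile, and at each side common to two adjacent tiles the red lines match (the line of one meets this side if and only if the line of the other does). If $n=0$ or $m=0$, then $\mathfrak M_{n,m}$ has exactly one element. Let $\alpha(M)$ be the number of cobracket tiles of $M$. **The morphism of a mosaic.** Rotate $M$ by 45 degrees clockwise, so that the red lines run from the left and bottom sides to the top and right sides. Each tile is a morphism from its left and bottom sides (in this order) to its top and right sides (in this order): $\tau$ for a permutation tile, $\mu$ for a bracket tile, $\delta$ for a cobracket tile, $\mathrm{id}_{[1]}$ for an action or coaction tile, $\mathrm{id}_{[0]}$ for an empty tile. Composing them gives a morphism $M^\top:[n+k]\to[m+l]$, where $k$ and $l$ are the numbers of red lines that meet the bottom and the right side of the grid. The inputs are the left ends of the rows from top to bottom, followed by the bottom ends of the columns from left to right; the outputs are the top ends of the columns from left to right, followed by the right ends of the rows from top to bottom. (If $n=0$ or $m=0$, $M^\top$ is the identity.) Put $$\varphi_{n,m}(M)=(\mathrm{id}_{[n]}\otimes\pi^{*(k)})\,;(M^\top\otimes\mathrm{id}_{[V_1]})\,;(\mathrm{id}_{[m]}\otimes\pi^{(l)})\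 :\ [n]\otimes[V_1]\to[m]\otimes[V_1].$$ **Proposition.** For all $n,m\ge 0$, in $\mathsf{DY}^1$, $$\pi^{(n)}\,;\pi^{*(m)}=\sum_{M\in\mathfrak M_{n,m}}(-1)^{\alpha(M)}\,\varphi_{n,m}(M).$$ -/

import Mathlib

open CategoryTheory MonoidalCategory

universe u

namespace DrinfeldYetter

/-! ### The coloured PROP of one Drinfeld-Yetter module over a Lie bialgebra -/

/-- The two colours: `b` is the Lie bialgebra object `[1]`, `v` is the module object `[V₁]`. -/
inductive Color
  | b
  | v
  deriving DecidableEq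

open Color in
/-- Formal morphism expressions between finite sequences of colours. They are built from the
generating morphisms by identities, composition (written from left to right), tensor products,
symmetries and `K`-linear combinations. -/
inductive Term (K : Type u) : List Color → List Color → Type u
  | zero (X Y : List Color) : Term K X Y
  | add {X Y : List Color} (f g : Term K X Y) : Term K X Y
  | smul {X Y : List Color} (c : K) (f : Term K X Y) : Term K X Y
  | id (X : List Color) : Term K X X
  | comp {X Y Z : List Color} (f : Term K X Y) (g : Term K Y Z) : Term K X Z
  | tensor {X Y X' Y' : List Color} (f : Term K X Y) (g : Term K X' Y') :
      Term K (X ++ X') (Y ++ Y')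
  | swap (X Y : List Color) : Term K (X ++ Y) (Y ++ X)
  /-- the universal Lie bracket `[2] ⟶ [1]` -/
  | mu : Term K [b, b] [b]
  /-- the universal Lie cobracket `[1] ⟶ [2]` -/
  | delta : Term K [b] [b, b]
  /-- the universal action `[1] ⊗ [V₁] ⟶ [V₁]` -/
  | act : Term K [b, v] [v]
  /-- the universal coaction `[V₁] ⟶ [1] ⊗ [V₁]` -/
  | coact : Term K [v] [b, v]

namespace Term

/-- The identity, seen as a morphism between two equal objects. -/
def ofEq (K : Type u) {X Y : List Color} (h : X = Y) : Term K X Y := h ▸ Term.id X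

end Term

open Color Term in
/-- The defining relations: the smallest congruence that makes the morphism expressions a
`K`-linear strict symmetric monoidal category, that makes `([b], mu, delta)` a Lie bialgebra
object, and that makes `([v], act, coact)` a Drinfeld-Yetter module over it. -/
inductive Rel (K : Type u) [Field K] : {X Y : List Color} → Term K X Y → Term K X Y → Prop
  -- equivalence relation and congruence
  | refl {X Y : List Color} (f : Term K X Y) : Rel K f f
  | symm {X Y : List Color} {f g : Term K X Y} : Rel K f g → Rel K g f
  | trans {X Y : List Color} {f g h : Term K X Y} : Rel K f g → Rel K g h → Rel K f h
  | congr_add {X Y : List Color} {f f' g g' : Term K X Y} :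
      Rel K f f' → Rel K g g' → Rel K (add f g) (add f' g')
  | congr_smul {X Y : List Color} (c : K) {f f' : Term K X Y} :
      Rel K f f' → Rel K (smul c f) (smul c f')
  | congr_comp {X Y Z : List Color} {f f' : Term K X Y} {g g' : Term K Y Z} :
      Rel K f f' → Rel K g g' → Rel K (comp f g) (comp f' g')
  | congr_tensor {X Y X' Y' : List Color} {f f' : Term K X Y} {g g' : Term K X' Y'} :
      Rel K f f' → Rel K g g' → Rel K (tensor f g) (tensor f' g')
  -- every set of morphisms is a `K`-vector space
  | add_assoc {X Y : List Color} (f g h : Term K X Y) :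
      Rel K (add (add f g) h) (add f (add g h))
  | add_comm {X Y : List Color} (f g : Term K X Y) : Rel K (add f g) (add g f)
  | zero_add {X Y : List Color} (f : Term K X Y) : Rel K (add (zero X Y) f) f
  | smul_add {X Y : List Color} (c : K) (f g : Term K X Y) :
      Rel K (smul c (add f g)) (add (smul c f) (smul c g))
  | add_smul {X Y : List Color} (c d : K) (f : Term K X Y) :
      Rel K (smul (c + d) f) (add (smul c f) (smul d f))
  | mul_smul {X Y : List Color} (c d : K) (f : Term K X Y) :
      Rel K (smul (c * d) f) (smul c (smul d f))
  | one_smul {X Y : List Color} (f : Term K X Y) : Rel K (smul 1 f) f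
  | zero_smul {X Y : List Color} (f : Term K X Y) : Rel K (smul 0 f) (zero X Y)
  -- category, with bilinear composition
  | id_comp {X Y : List Color} (f : Term K X Y) : Rel K (comp (id X) f) f
  | comp_id {X Y : List Color} (f : Term K X Y) : Rel K (comp f (id Y)) f
  | comp_assoc {X Y Z W : List Color} (f : Term K X Y) (g : Term K Y Z) (h : Term K Z W) :
      Rel K (comp (comp f g) h) (comp f (comp g h))
  | add_comp {X Y Z : List Color} (f f' : Term K X Y) (g : Term K Y Z) :
      Rel K (comp (add f f') g) (add (comp f g) (comp f' g))
  | comp_add {X Y Z : List Color} (f : Term K X Y) (g g' : Term K Y Z) :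
      Rel K (comp f (add g g')) (add (comp f g) (comp f g'))
  | smul_comp {X Y Z : List Color} (c : K) (f : Term K X Y) (g : Term K Y Z) :
      Rel K (comp (smul c f) g) (smul c (comp f g))
  | comp_smul {X Y Z : List Color} (c : K) (f : Term K X Y) (g : Term K Y Z) :
      Rel K (comp f (smul c g)) (smul c (comp f g))
  -- strict monoidal structure, with bilinear tensor product
  | tensor_id (X Y : List Color) : Rel K (tensor (id X) (id Y)) (id (X ++ Y))
  | tensor_comp {X Y Z X' Y' Z' : List Color} (f : Term K X Y) (g : Term K Y Z)
      (f' : Term K X' Y') (g' : Term K Y' Z') :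
      Rel K (tensor (comp f g) (comp f' g')) (comp (tensor f f') (tensor g g'))
  | add_tensor {X Y X' Y' : List Color} (f f' : Term K X Y) (g : Term K X' Y') :
      Rel K (tensor (add f f') g) (add (tensor f g) (tensor f' g))
  | tensor_add {X Y X' Y' : List Color} (f : Term K X Y) (g g' : Term K X' Y') :
      Rel K (tensor f (add g g')) (add (tensor f g) (tensor f g'))
  | smul_tensor {X Y X' Y' : List Color} (c : K) (f : Term K X Y) (g : Term K X' Y') :
      Rel K (tensor (smul c f) g) (smul c (tensor f g))
  | tensor_smul {X Y X' Y' : List Color} (c : K) (f : Term K X Y) (g : Term K X' Y') :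
      Rel K (tensor f (smul c g)) (smul c (tensor f g))
  | tensor_assoc {X Y X' Y' X'' Y'' : List Color} (f : Term K X Y) (g : Term K X' Y')
      (h : Term K X'' Y'') :
      Rel K (comp (tensor (tensor f g) h) (ofEq K (List.append_assoc Y Y' Y'')))
        (comp (ofEq K (List.append_assoc X X' X'')) (tensor f (tensor g h)))
  | id_tensor {X Y : List Color} (f : Term K X Y) : Rel K (tensor (id []) f) f
  | tensor_unit {X Y : List Color} (f : Term K X Y) :
      Rel K (comp (tensor f (id [])) (ofEq K (List.append_nil Y)))
        (comp (ofEq K (List.append_nil X)) f)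
  -- symmetry
  | swap_natural {X Y X' Y' : List Color} (f : Term K X Y) (g : Term K X' Y') :
      Rel K (comp (tensor f g) (swap Y Y')) (comp (swap X X') (tensor g f))
  | swap_swap (X Y : List Color) : Rel K (comp (swap X Y) (swap Y X)) (id (X ++ Y))
  | hexagon (X Y Z : List Color) :
      Rel K
        (comp (ofEq K (List.append_assoc X Y Z))
          (comp (swap X (Y ++ Z)) (ofEq K (List.append_assoc Y Z X))))
        (comp (tensor (swap X Y) (id Z))
          (comp (ofEq K (List.append_assoc Y X Z)) (tensor (id Y) (swap X Z))))
  -- Lie bialgebra: antisymmetry and Jacobi identity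
  | mu_antisymm :
      Rel K (comp (Y := [b, b]) (add (id [b, b]) (swap [b] [b])) mu) (zero [b, b] [b])
  | jacobi :
      Rel K
        (comp (Y := [b, b, b]) (add (add (id [b, b, b]) (swap [b] [b, b])) (swap [b, b] [b]))
          (comp (Y := [b, b]) (tensor mu (id [b])) mu))
        (zero [b, b, b] [b])
  -- Lie bialgebra: coantisymmetry and coJacobi identity
  | delta_antisymm :
      Rel K (comp (Y := [b, b]) delta (add (id [b, b]) (swap [b] [b]))) (zero [b] [b, b])
  | coJacobi :
      Rel K
        (comp (Y := [b, b, b]) (comp (Y := [b, b]) delta (tensor delta (id [b])))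
          (add (add (id [b, b, b]) (swap [b] [b, b])) (swap [b, b] [b])))
        (zero [b] [b, b, b])
  -- Lie bialgebra: cocycle condition
  | cocycle :
      Rel K (comp mu delta)
        (comp (Y := [b, b]) (add (id [b, b]) (smul (-1) (swap [b] [b])))
          (comp (Y := [b, b, b]) (tensor delta (id [b]))
            (comp (Y := [b, b]) (tensor (id [b]) mu)
              (add (id [b, b]) (smul (-1) (swap [b] [b]))))))
  -- Drinfeld-Yetter module: Lie action
  | lie_action :
      Rel K (comp (Y := [b, v]) (tensor mu (id [v])) act)
        (add (comp (Y := [b, v]) (tensor (id [b]) act) act)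
          (smul (-1)
            (comp (Y := [b, b, v]) (tensor (swap [b] [b]) (id [v]))
              (comp (Y := [b, v]) (tensor (id [b]) act) act))))
  -- Drinfeld-Yetter module: Lie coaction
  | lie_coaction :
      Rel K (comp (Y := [b, v]) coact (tensor delta (id [v])))
        (add
          (comp (Y := [b, v]) coact
            (comp (Y := [b, b, v]) (tensor (id [b]) coact) (tensor (swap [b] [b]) (id [v]))))
          (smul (-1) (comp (Y := [b, v]) coact (tensor (id [b]) coact))))
  -- Drinfeld-Yetter module: Drinfeld-Yetter relation
  | drinfeldYetter :
      Rel K (comp act coact)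
        (add
          (comp (Y := [b, b, v]) (tensor (id [b]) coact)
            (add
              (comp (Y := [b, b, v]) (tensor (swap [b] [b]) (id [v])) (tensor (id [b]) act))
              (tensor mu (id [v]))))
          (smul (-1) (comp (Y := [b, b, v]) (tensor delta (id [v])) (tensor (id [b]) act))))

/-- Morphism expressions are identified when the defining relations say so. -/
def termSetoid (K : Type u) [Field K] (X Y : List Color) : Setoid (Term K X Y) where
  r := Rel K
  iseqv := ⟨Rel.refl, Rel.symm, Rel.trans⟩

/-- The coloured PROP `DY¹` over `K`: its objects are the finite sequences of colours. -/
@[ext]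
structure DY1 (K : Type u) : Type where
  /-- the sequence of colours -/
  word : List Color

namespace DY1

section Structure

variable {K : Type u} [Field K]

/-- The morphisms of `DY¹` are the morphism expressions modulo the defining relations. -/
instance : Category (DY1 K) where
  Hom X Y := Quotient (termSetoid K X.word Y.word)
  id X := Quotient.mk _ (Term.id X.word)
  comp f g := Quotient.map₂ Term.comp (fun _ _ h _ _ h' => Rel.congr_comp h h') f g
  id_comp f := by
    induction f using Quotient.inductionOn
    exact Quotient.sound (Rel.id_comp _)
  comp_id f := by
    induction f using Quotient.inductionOn
    exact Quotient.sound (Rel.comp_id _)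
  assoc f g h := by
    induction f using Quotient.inductionOn
    induction g using Quotient.inductionOn
    induction h using Quotient.inductionOn
    exact Quotient.sound (Rel.comp_assoc _ _ _)

/-- The morphism of `DY¹` represented by an expression. -/
def homMk {X Y : DY1 K} (f : Term K X.word Y.word) : X ⟶ Y :=
  Quotient.mk (termSetoid K X.word Y.word) f

theorem homMk_surjective {X Y : DY1 K} (f : X ⟶ Y) :
    ∃ t : Term K X.word Y.word, homMk t = f := Quotient.exists_rep f

theorem homMk_eq {X Y : DY1 K} {f g : Term K X.word Y.word} (h : Rel K f g) :
    (homMk f : X ⟶ Y) = homMk g := Quotient.sound h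

theorem homMk_ofEq {X Y : DY1 K} (h : X.word = Y.word) :
    (homMk (Term.ofEq K h) : X ⟶ Y) = eqToHom (DY1.ext h) := by
  cases X
  cases Y
  cases h
  rfl

instance (X Y : DY1 K) : Zero (X ⟶ Y) := ⟨homMk (Term.zero X.word Y.word)⟩

instance (X Y : DY1 K) : Add (X ⟶ Y) :=
  ⟨fun f g => Quotient.map₂ Term.add (fun _ _ h _ _ h' => Rel.congr_add h h') f g⟩

instance (X Y : DY1 K) : SMul K (X ⟶ Y) :=
  ⟨fun c f => Quotient.map (Term.smul c) (fun _ _ h => Rel.congr_smul c h) f⟩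

instance (X Y : DY1 K) : Neg (X ⟶ Y) := ⟨fun f => (-1 : K) • f⟩

instance (X Y : DY1 K) : AddCommGroup (X ⟶ Y) where
  nsmul := nsmulRec
  zsmul := zsmulRec
  add_assoc f g h := by
    induction f using Quotient.inductionOn
    induction g using Quotient.inductionOn
    induction h using Quotient.inductionOn
    exact Quotient.sound (Rel.add_assoc _ _ _)
  zero_add f := by
    induction f using Quotient.inductionOn
    exact Quotient.sound (Rel.zero_add _)
  add_zero f := by
    induction f using Quotient.inductionOn
    exact Quotient.sound ((Rel.add_comm _ _).trans (Rel.zero_add _))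
  add_comm f g := by
    induction f using Quotient.inductionOn
    induction g using Quotient.inductionOn
    exact Quotient.sound (Rel.add_comm _ _)
  neg_add_cancel f := by
    induction f using Quotient.inductionOn with | _ f
    refine Quotient.sound ?_
    refine Rel.trans (Rel.congr_add (Rel.refl _) (Rel.one_smul f).symm) ?_
    refine Rel.trans (Rel.add_smul (-1) 1 f).symm ?_
    rw [neg_add_cancel]
    exact Rel.zero_smul f

instance (X Y : DY1 K) : Module K (X ⟶ Y) where
  one_smul f := by
    induction f using Quotient.inductionOn
    exact Quotient.sound (Rel.one_smul _)
  mul_smul c d f := by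
    induction f using Quotient.inductionOn
    exact Quotient.sound (Rel.mul_smul _ _ _)
  smul_add c f g := by
    induction f using Quotient.inductionOn
    induction g using Quotient.inductionOn
    exact Quotient.sound (Rel.smul_add _ _ _)
  add_smul c d f := by
    induction f using Quotient.inductionOn
    exact Quotient.sound (Rel.add_smul _ _ _)
  zero_smul f := by
    induction f using Quotient.inductionOn
    exact Quotient.sound (Rel.zero_smul _)
  smul_zero c := by
    refine Quotient.sound ?_
    refine Rel.trans (Rel.congr_smul c (Rel.zero_smul (Term.zero X.word Y.word)).symm) ?_
    refine Rel.trans (Rel.mul_smul c 0 _).symm ?_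
    rw [mul_zero]
    exact Rel.zero_smul _

instance : Preadditive (DY1 K) where
  add_comp X Y Z f f' g := by
    induction f using Quotient.inductionOn
    induction f' using Quotient.inductionOn
    induction g using Quotient.inductionOn
    exact Quotient.sound (Rel.add_comp _ _ _)
  comp_add X Y Z f g g' := by
    induction f using Quotient.inductionOn
    induction g using Quotient.inductionOn
    induction g' using Quotient.inductionOn
    exact Quotient.sound (Rel.comp_add _ _ _)

instance : Linear K (DY1 K) where
  smul_comp X Y Z c f g := by
    induction f using Quotient.inductionOn
    induction g using Quotient.inductionOn
    exact Quotient.sound (Rel.smul_comp _ _ _)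
  comp_smul X Y Z f c g := by
    induction f using Quotient.inductionOn
    induction g using Quotient.inductionOn
    exact Quotient.sound (Rel.comp_smul _ _ _)

/-- Tensor products are concatenations, and all structural isomorphisms are identities (between
equal objects). -/
instance : MonoidalCategoryStruct (DY1 K) where
  tensorObj X Y := ⟨X.word ++ Y.word⟩
  tensorUnit := ⟨[]⟩
  tensorHom f g := Quotient.map₂ Term.tensor (fun _ _ h _ _ h' => Rel.congr_tensor h h') f g
  whiskerLeft X _ _ f :=
    Quotient.map (Term.tensor (Term.id X.word)) (fun _ _ h => Rel.congr_tensor (Rel.refl _) h) f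
  whiskerRight f X :=
    Quotient.map (fun t => Term.tensor t (Term.id X.word))
      (fun _ _ h => Rel.congr_tensor h (Rel.refl _)) f
  associator X Y Z := eqToIso (DY1.ext (List.append_assoc X.word Y.word Z.word))
  leftUnitor X := eqToIso (DY1.ext (List.nil_append X.word))
  rightUnitor X := eqToIso (DY1.ext (List.append_nil X.word))

theorem associator_hom (X Y Z : DY1 K) :
    (α_ X Y Z).hom = eqToHom (DY1.ext (List.append_assoc X.word Y.word Z.word)) := rfl

theorem leftUnitor_hom (X : DY1 K) :
    (λ_ X).hom = eqToHom (DY1.ext (List.nil_append X.word)) := rfl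

theorem rightUnitor_hom (X : DY1 K) :
    (ρ_ X).hom = eqToHom (DY1.ext (List.append_nil X.word)) := rfl

theorem eqToHom_tensor_id {X Y : DY1 K} (h : X = Y) (Z : DY1 K) :
    eqToHom h ⊗ₘ 𝟙 Z = eqToHom (by rw [h]) := by
  subst h
  exact homMk_eq (Rel.tensor_id _ _)

theorem id_tensor_eqToHom (Z : DY1 K) {X Y : DY1 K} (h : X = Y) :
    𝟙 Z ⊗ₘ eqToHom h = eqToHom (by rw [h]) := by
  subst h
  exact homMk_eq (Rel.tensor_id _ _)

instance : MonoidalCategory (DY1 K) := MonoidalCategory.ofTensorHom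
  (id_tensorHom_id := fun X Y => homMk_eq (Rel.tensor_id _ _))
  (id_tensorHom := by
    intro _ _ _ f
    obtain ⟨f, rfl⟩ := homMk_surjective f
    rfl)
  (tensorHom_id := by
    intro _ _ f _
    obtain ⟨f, rfl⟩ := homMk_surjective f
    rfl)
  (tensorHom_comp_tensorHom := by
    intro _ _ _ _ _ _ f g f' g'
    obtain ⟨f, rfl⟩ := homMk_surjective f
    obtain ⟨g, rfl⟩ := homMk_surjective g
    obtain ⟨f', rfl⟩ := homMk_surjective f'
    obtain ⟨g', rfl⟩ := homMk_surjective g'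
    exact homMk_eq (Rel.tensor_comp _ _ _ _).symm)
  (associator_naturality := by
    intro X₁ X₂ X₃ Y₁ Y₂ Y₃ f g h
    obtain ⟨f, rfl⟩ := homMk_surjective f
    obtain ⟨g, rfl⟩ := homMk_surjective g
    obtain ⟨h, rfl⟩ := homMk_surjective h
    have key : (homMk _ : (X₁ ⊗ X₂) ⊗ X₃ ⟶ Y₁ ⊗ (Y₂ ⊗ Y₃)) = homMk _ :=
      homMk_eq (Rel.tensor_assoc f g h)
    refine Eq.trans ?_ (key.trans ?_)
    · exact congrArg (fun t => ((homMk f ⊗ₘ homMk g) ⊗ₘ homMk h) ≫ t)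
        (homMk_ofEq (X := (Y₁ ⊗ Y₂) ⊗ Y₃) (Y := Y₁ ⊗ (Y₂ ⊗ Y₃)) (List.append_assoc _ _ _)).symm
    · exact congrArg (fun t => t ≫ (homMk f ⊗ₘ (homMk g ⊗ₘ homMk h)))
        (homMk_ofEq (X := (X₁ ⊗ X₂) ⊗ X₃) (Y := X₁ ⊗ (X₂ ⊗ X₃)) (List.append_assoc _ _ _)))
  (leftUnitor_naturality := by
    intro X Y f
    obtain ⟨f, rfl⟩ := homMk_surjective f
    have key : (homMk _ : 𝟙_ (DY1 K) ⊗ X ⟶ Y) = homMk _ := homMk_eq (Rel.id_tensor f)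
    exact (Category.comp_id _).trans (key.trans (Category.id_comp _).symm))
  (rightUnitor_naturality := by
    intro X Y f
    obtain ⟨f, rfl⟩ := homMk_surjective f
    have key : (homMk _ : X ⊗ 𝟙_ (DY1 K) ⟶ Y) = homMk _ := homMk_eq (Rel.tensor_unit f)
    refine Eq.trans ?_ (key.trans ?_)
    · exact congrArg (fun t => (homMk f ⊗ₘ 𝟙 (𝟙_ (DY1 K))) ≫ t)
        (homMk_ofEq (X := Y ⊗ 𝟙_ (DY1 K)) (Y := Y) (List.append_nil _)).symm
    · exact congrArg (fun t => t ≫ homMk f)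
        (homMk_ofEq (X := X ⊗ 𝟙_ (DY1 K)) (Y := X) (List.append_nil _)))
  (pentagon := by
    intro W X Y Z
    rw [associator_hom, associator_hom, associator_hom, associator_hom, associator_hom,
      eqToHom_tensor_id, id_tensor_eqToHom]
    simp)
  (triangle := by
    intro X Y
    rw [associator_hom, leftUnitor_hom, rightUnitor_hom, eqToHom_tensor_id, id_tensor_eqToHom]
    simp)

instance : MonoidalPreadditive (DY1 K) where
  whiskerLeft_zero {X Y Z} := by
    refine homMk_eq (f := Term.tensor (Term.id X.word) (Term.zero Y.word Z.word)) ?_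
    refine Rel.trans (Rel.congr_tensor (Rel.refl _) (Rel.zero_smul (Term.zero _ _)).symm) ?_
    exact (Rel.tensor_smul _ _ _).trans (Rel.zero_smul _)
  zero_whiskerRight {X Y Z} := by
    refine homMk_eq (f := Term.tensor (Term.zero Y.word Z.word) (Term.id X.word)) ?_
    refine Rel.trans (Rel.congr_tensor (Rel.zero_smul (Term.zero _ _)).symm (Rel.refl _)) ?_
    exact (Rel.smul_tensor _ _ _).trans (Rel.zero_smul _)
  whiskerLeft_add f g := by
    obtain ⟨f, rfl⟩ := homMk_surjective f
    obtain ⟨g, rfl⟩ := homMk_surjective g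
    exact homMk_eq (Rel.tensor_add _ _ _)
  add_whiskerRight f g := by
    obtain ⟨f, rfl⟩ := homMk_surjective f
    obtain ⟨g, rfl⟩ := homMk_surjective g
    exact homMk_eq (Rel.add_tensor _ _ _)

instance : MonoidalLinear K (DY1 K) where
  whiskerLeft_smul X _ _ c f := by
    obtain ⟨f, rfl⟩ := homMk_surjective f
    exact homMk_eq (Rel.tensor_smul _ _ _)
  smul_whiskerRight c _ _ f X := by
    obtain ⟨f, rfl⟩ := homMk_surjective f
    exact homMk_eq (Rel.smul_tensor _ _ _)

/-- The symmetry of `DY¹`. -/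
def swapIso (X Y : DY1 K) : X ⊗ Y ≅ Y ⊗ X where
  hom := homMk (Term.swap X.word Y.word)
  inv := homMk (Term.swap Y.word X.word)
  hom_inv_id := homMk_eq (Rel.swap_swap _ _)
  inv_hom_id := homMk_eq (Rel.swap_swap _ _)

theorem swapIso_hexagon (X Y Z : DY1 K) :
    (α_ X Y Z).hom ≫ (swapIso X (Y ⊗ Z)).hom ≫ (α_ Y Z X).hom =
      ((swapIso X Y).hom ▷ Z) ≫ (α_ Y X Z).hom ≫ (Y ◁ (swapIso X Z).hom) := by
  have e (X Y Z : DY1 K) : (α_ X Y Z).hom =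
      homMk (Term.ofEq K (List.append_assoc X.word Y.word Z.word)) :=
    (homMk_ofEq (X := (X ⊗ Y) ⊗ Z) (Y := X ⊗ (Y ⊗ Z)) (List.append_assoc _ _ _)).symm
  rw [e, e, e]
  exact homMk_eq (Rel.hexagon X.word Y.word Z.word)

instance : SymmetricCategory (DY1 K) where
  braiding := swapIso
  braiding_naturality_right X Y Z f := by
    obtain ⟨f, rfl⟩ := homMk_surjective f
    exact homMk_eq (Rel.swap_natural (Term.id X.word) f)
  braiding_naturality_left f Z := by
    obtain ⟨f, rfl⟩ := homMk_surjective f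
    exact homMk_eq (Rel.swap_natural f (Term.id Z.word))
  hexagon_forward := swapIso_hexagon
  hexagon_reverse X Y Z := by
    have h : (α_ Z X Y) ≪≫ swapIso Z (X ⊗ Y) ≪≫ (α_ X Y Z) =
        whiskerRightIso (swapIso Z X) Y ≪≫ (α_ X Z Y) ≪≫ whiskerLeftIso X (swapIso Z Y) :=
      Iso.ext (swapIso_hexagon Z X Y)
    have h' := congrArg Iso.inv h
    simp only [Iso.trans_inv, whiskerRightIso_inv, whiskerLeftIso_inv, Category.assoc] at h'
    exact h'
  symmetry X Y := homMk_eq (Rel.swap_swap _ _)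

end Structure

section Generators

variable (K : Type u) [Field K]

/-- The Lie bialgebra object `[1]`. -/
def B : DY1 K := ⟨[Color.b]⟩

/-- The Drinfeld-Yetter module object `[V₁]`. -/
def V : DY1 K := ⟨[Color.v]⟩

/-- The universal Lie bracket. -/
def mu : B K ⊗ B K ⟶ B K := homMk (X := B K ⊗ B K) (Y := B K) Term.mu

/-- The universal Lie cobracket. -/
def delta : B K ⟶ B K ⊗ B K := homMk (X := B K) (Y := B K ⊗ B K) Term.delta

/-- The universal action. -/
def act : B K ⊗ V K ⟶ V K := homMk (X := B K ⊗ V K) (Y := V K) Term.act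

/-- The universal coaction. -/
def coact : V K ⟶ B K ⊗ V K := homMk (X := V K) (Y := B K ⊗ V K) Term.coact

/-- The object `[n]`, the `n`-fold tensor power of `[1]`. -/
def Bpow : ℕ → DY1 K
  | 0 => 𝟙_ (DY1 K)
  | n + 1 => B K ⊗ Bpow n

/-- The `n`-th iterated action `[n] ⊗ [V₁] ⟶ [V₁]`: the last strand acts first. -/
def actIter : (n : ℕ) → (Bpow K n ⊗ V K ⟶ V K)
  | 0 => (λ_ (V K)).hom
  | n + 1 => (α_ (B K) (Bpow K n) (V K)).hom ≫ (B K ◁ actIter n) ≫ act K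

/-- The `m`-th iterated coaction `[V₁] ⟶ [m] ⊗ [V₁]`: the first coaction gives the first
strand. -/
def coactIter : (m : ℕ) → (V K ⟶ Bpow K m ⊗ V K)
  | 0 => (λ_ (V K)).inv
  | m + 1 => coact K ≫ (B K ◁ coactIter m) ≫ (α_ (B K) (Bpow K m) (V K)).inv

end Generators

end DY1

/-! ### Drinfeld-Yetter mosaics -/

/-- The six tiles. In the pictures, the red line of
`permutation` joins all four sides, that of `bracket` the left, bottom and top sides, that of
`cobracket` the left, top and right sides, that of `action` the left and right sides, that of
`coaction` the bottom and top sides; `empty` has no red line. -/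
inductive Tile
  | permutation
  | bracket
  | cobracket
  | action
  | coaction
  | empty
  deriving DecidableEq

namespace Tile

/-- Does the red line meet the left side? -/
def left : Tile → Bool
  | permutation | bracket | cobracket | action => true
  | coaction | empty => false

/-- Does the red line meet the right side? -/
def right : Tile → Bool
  | permutation | cobracket | action => true
  | bracket | coaction | empty => false

/-- Does the red line meet the top side? -/
def top : Tile → Bool
  | permutation | bracket | cobracket | coaction => true
  | action | empty => false

/-- Does the red line meet the bottom side? -/
def bottom : Tile → Bool
  | permutation | bracket | coaction => true
  | cobracket | action | empty => false

/-- The forbidden horizontal configurations (left tile, right tile). -/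
def forbiddenRow : List (Tile × Tile) :=
  [(permutation, empty), (permutation, coaction), (bracket, cobracket), (bracket, action),
    (bracket, permutation), (cobracket, coaction),
    (cobracket, empty), (action, coaction), (action, empty), (coaction, permutation),
    (coaction, bracket), (coaction, cobracket),
    (coaction, action), (empty, permutation), (empty, bracket), (empty, cobracket),
    (empty, action), (bracket, bracket)]

/-- The forbidden vertical configurations (upper tile, lower tile). -/
def forbiddenColumn : List (Tile × Tile) :=
  [(permutation, action), (permutation, empty), (bracket, action), (bracket, empty),
    (cobracket, permutation), (cobracket, bracket), (cobracket, coaction), (coaction, action),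
    (coaction, empty),
    (action, permutation), (action, bracket), (action, cobracket), (action, coaction),
    (empty, permutation), (empty, bracket), (empty, cobracket), (empty, coaction),
    (cobracket, cobracket)]

/-- The forbidden horizontal configurations are those where the red lines are discontinuous. -/
theorem notMem_forbiddenRow_iff (s t : Tile) : (s, t) ∉ forbiddenRow ↔ s.right = t.left := by
  cases s <;> cases t <;> decide

/-- The forbidden vertical configurations are those where the red lines are discontinuous. -/
theorem notMem_forbiddenColumn_iff (s t : Tile) :
    (s, t) ∉ forbiddenColumn ↔ s.bottom = t.top := by
  cases s <;> cases t <;> decide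

end Tile

/-- A tiling of the grid with `n` rows and `m` columns; `M i j` is the tile in row `i` (from the
top) and column `j` (from the left). -/
abbrev Tiling (n m : ℕ) : Type := Fin n → Fin m → Tile

/-- The conditions for a tiling to be a Drinfeld-Yetter mosaic: all top sides of the first row and
all left sides of the first column carry a red line, and no forbidden configuration occurs. -/
structure IsMosaic {n m : ℕ} (M : Tiling n m) : Prop where
  firstRow : ∀ i j, i.val = 0 → M i j ≠ Tile.action ∧ M i j ≠ Tile.empty
  firstColumn : ∀ i j, j.val = 0 → M i j ≠ Tile.coaction ∧ M i j ≠ Tile.empty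
  row : ∀ i (j j' : Fin m), j'.val = j.val + 1 → (M i j, M i j') ∉ Tile.forbiddenRow
  column : ∀ (i i' : Fin n) j, i'.val = i.val + 1 → (M i j, M i' j) ∉ Tile.forbiddenColumn

/-- The set of `n × m` Drinfeld-Yetter mosaics. For `n = 0` or `m = 0` it has exactly one element,
the tiling of the empty grid. -/
def Mosaic (n m : ℕ) : Type := {M : Tiling n m // IsMosaic M}

noncomputable instance (n m : ℕ) : Fintype (Mosaic n m) := by
  classical
  letI : Fintype Tile :=
    ⟨{.permutation, .bracket, .cobracket, .action, .coaction, .empty}, by intro t; cases t <;> simp⟩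
  exact Subtype.fintype _

/-- The number of cobracket tiles of a mosaic. -/
def Mosaic.alpha {n m : ℕ} (M : Mosaic n m) : ℕ :=
  (Finset.univ.filter fun p : Fin n × Fin m => M.1 p.1 p.2 = Tile.cobracket).card

/-! ### The morphism read off a mosaic

After a rotation of 45 degrees clockwise the red lines run from the left and bottom sides of the
grid to its top and right sides. On the left (bottom, top, right) side of a rectangle the strands
are ordered from top to bottom (from left to right, from left to right, from top to bottom); the
strands of the left side precede those of the bottom side, and the strands of the top side precede
those of the right side. -/

section Morphism

variable (K : Type u) [Field K]

/-- `[1]` where there is a strand, the unit object `[0]` where there is none. -/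
def strand : Bool → DY1 K
  | true => DY1.B K
  | false => 𝟙_ (DY1 K)

/-- The object given by a sequence of sides of which some carry a strand. -/
def strands : {k : ℕ} → (Fin k → Bool) → DY1 K
  | 0, _ => 𝟙_ (DY1 K)
  | _ + 1, p => strand K (p 0) ⊗ strands (fun j => p j.succ)

/-- The number of strands in a sequence of sides. -/
def count {k : ℕ} (p : Fin k → Bool) : ℕ := (Finset.univ.filter fun j => p j = true).card

theorem strands_eq_Bpow {k : ℕ} (p : Fin k → Bool) : strands K p = DY1.Bpow K (count p) := by
  induction k with
  | zero => rfl
  | succ k ih =>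
    have hc : count p = if p 0 = true then count (fun j => p j.succ) + 1
        else count fun j => p j.succ := Fin.card_filter_univ_succ _
    rw [hc, strands, ih]
    cases p 0
    · rfl
    · rfl

/-- The morphism of a single tile, from its left and bottom sides to its top and right sides. The
structural isomorphisms that occur are identities. -/
def Tile.hom : (t : Tile) →
    (strand K t.left ⊗ strand K t.bottom ⟶ strand K t.top ⊗ strand K t.right)
  | permutation => (β_ (DY1.B K) (DY1.B K)).hom
  | bracket => DY1.mu K ≫ (ρ_ (DY1.B K)).inv
  | cobracket => (ρ_ (DY1.B K)).hom ≫ DY1.delta K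
  | action => (ρ_ (DY1.B K)).hom ≫ (λ_ (DY1.B K)).inv
  | coaction => (λ_ (DY1.B K)).hom ≫ (ρ_ (DY1.B K)).inv
  | empty => 𝟙 (𝟙_ (DY1 K) ⊗ 𝟙_ (DY1 K))

/-- The right side of a row of tiles whose left side is `l`. -/
def rowRight : {m : ℕ} → Bool → (Fin m → Tile) → Bool
  | 0, l, _ => l
  | _ + 1, _, r => rowRight (r 0).right (fun j => r j.succ)

/-- The red lines of a row of tiles with left side `l` match horizontally. -/
def RowMatches : {m : ℕ} → Bool → (Fin m → Tile) → Prop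
  | 0, _, _ => True
  | _ + 1, l, r => l = (r 0).left ∧ RowMatches (r 0).right (fun j => r j.succ)

/-- The morphism of a row of tiles, from its left side and its bottom sides to its top sides and
its right side: the tiles are applied from left to right. -/
def rowHom : {m : ℕ} → (l : Bool) → (r : Fin m → Tile) → RowMatches l r →
    (strand K l ⊗ strands K (fun j => (r j).bottom) ⟶
      strands K (fun j => (r j).top) ⊗ strand K (rowRight l r))
  | 0, l, _, _ => (ρ_ (strand K l)).hom ≫ (λ_ (strand K l)).inv
  | m + 1, _, r, h =>
    (eqToHom (congrArg (strand K) h.1) ▷ _) ≫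
    (α_ (strand K (r 0).left) (strand K (r 0).bottom)
      (strands K fun j : Fin m => (r j.succ).bottom)).inv ≫
    ((r 0).hom K ▷ _) ≫
    (α_ (strand K (r 0).top) (strand K (r 0).right)
      (strands K fun j : Fin m => (r j.succ).bottom)).hom ≫
    (strand K (r 0).top ◁ rowHom (r 0).right (fun j => r j.succ) h.2) ≫
    (α_ (strand K (r 0).top) (strands K fun j : Fin m => (r j.succ).top)
      (strand K (rowRight (r 0).right fun j : Fin m => r j.succ))).inv

/-- The bottom sides of a tiling whose top sides are `t`. -/
def bottomSides {m : ℕ} : {n : ℕ} → (Fin m → Bool) → Tiling n m → Fin m → Bool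
  | 0, t, _ => t
  | _ + 1, _, M => bottomSides (fun j => (M 0 j).bottom) (fun i => M i.succ)

/-- The right sides of a tiling all of whose left sides carry a strand. -/
def rightSides {n m : ℕ} (M : Tiling n m) : Fin n → Bool := fun i => rowRight true (M i)

/-- The red lines of a tiling with top sides `t`, all of whose left sides carry a strand, match. -/
def TilingMatches {m : ℕ} : {n : ℕ} → (Fin m → Bool) → Tiling n m → Prop
  | 0, _, _ => True
  | _ + 1, t, M => RowMatches true (M 0) ∧ (t = fun j => (M 0 j).top) ∧
      TilingMatches (fun j => (M 0 j).bottom) (fun i => M i.succ)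

/-- The morphism of a tiling, from its left sides and its bottom sides to its top sides and its
right sides: the rows are applied from bottom to top. -/
def tilingHom {m : ℕ} : {n : ℕ} → (t : Fin m → Bool) → (M : Tiling n m) → TilingMatches t M →
    (DY1.Bpow K n ⊗ strands K (bottomSides t M) ⟶ strands K t ⊗ strands K (rightSides M))
  | 0, t, _, _ => (λ_ (strands K t)).hom ≫ (ρ_ (strands K t)).inv
  | n + 1, _, M, h =>
    (α_ (DY1.B K) (DY1.Bpow K n)
      (strands K (bottomSides (fun j => (M 0 j).bottom) fun i : Fin n => M i.succ))).hom ≫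
    (DY1.B K ◁ tilingHom (fun j => (M 0 j).bottom) (fun i => M i.succ) h.2.2) ≫
    (α_ (DY1.B K) (strands K fun j => (M 0 j).bottom)
      (strands K (rightSides fun i : Fin n => M i.succ))).inv ≫
    (rowHom K true (M 0) h.1 ▷ _) ≫
    (α_ (strands K fun j => (M 0 j).top) (strand K (rowRight true (M 0)))
      (strands K (rightSides fun i : Fin n => M i.succ))).hom ≫
    (eqToHom (congrArg (strands K) h.2.1.symm) ▷ _)

theorem rowMatches_of_forall {m : ℕ} (l : Bool) (r : Fin m → Tile)
    (h0 : ∀ j, j.val = 0 → l = (r j).left)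
    (h : ∀ j j' : Fin m, j'.val = j.val + 1 → (r j).right = (r j').left) : RowMatches l r := by
  induction m generalizing l with
  | zero => trivial
  | succ m ih =>
    refine ⟨h0 0 rfl, ih _ _ (fun j hj => h 0 j.succ ?_) fun j j' hj => h j.succ j'.succ ?_⟩
    · simp [hj]
    · simp [hj]

theorem tilingMatches_of_forall {n m : ℕ} (t : Fin m → Bool) (M : Tiling n m)
    (hr : ∀ i, RowMatches true (M i)) (h0 : ∀ i j, i.val = 0 → t j = (M i j).top)
    (h : ∀ (i i' : Fin n) j, i'.val = i.val + 1 → (M i j).bottom = (M i' j).top) :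
    TilingMatches t M := by
  induction n generalizing t with
  | zero => trivial
  | succ n ih =>
    refine ⟨hr 0, funext fun j => h0 0 j rfl, ih _ _ (fun i => hr i.succ)
      (fun i j hi => h 0 i.succ j ?_) fun i i' j hi => h i.succ i'.succ j ?_⟩
    · simp [hi]
    · simp [hi]

theorem Mosaic.tilingMatches {n m : ℕ} (M : Mosaic n m) :
    TilingMatches (fun _ => true) M.1 := by
  refine tilingMatches_of_forall _ _ (fun i => rowMatches_of_forall _ _ (fun j hj => ?_)
    fun j j' hj => (Tile.notMem_forbiddenRow_iff _ _).1 (M.2.row i j j' hj))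
    (fun i j hi => ?_) fun i i' j hi => (Tile.notMem_forbiddenColumn_iff _ _).1 (M.2.column i i' j hi)
  · have := M.2.firstColumn i j hj
    revert this
    cases M.1 i j <;> simp [Tile.left]
  · have := M.2.firstRow i j hi
    revert this
    cases M.1 i j <;> simp [Tile.top]

/-- The morphism `[n] ⊗ [V₁] ⟶ [m] ⊗ [V₁]` read off a mosaic: first `[V₁]` coacts once for each
strand of the bottom side, then the mosaic is applied, and then the strands of the right side act on
`[V₁]`. -/
def Mosaic.phi {n m : ℕ} (M : Mosaic n m) :
    DY1.Bpow K n ⊗ DY1.V K ⟶ DY1.Bpow K m ⊗ DY1.V K :=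
  (DY1.Bpow K n ◁ DY1.coactIter K (count (bottomSides (fun _ => true) M.1))) ≫
  (α_ (DY1.Bpow K n) (DY1.Bpow K (count (bottomSides (fun _ => true) M.1))) (DY1.V K)).inv ≫
  (((DY1.Bpow K n ◁ eqToHom (strands_eq_Bpow K _).symm) ≫
    tilingHom K (fun _ => true) M.1 M.tilingMatches ≫
    (eqToHom (by rw [strands_eq_Bpow]; simp [count]) ⊗ₘ eqToHom (strands_eq_Bpow K _))) ▷
      DY1.V K) ≫
  (α_ (DY1.Bpow K m) (DY1.Bpow K (count (rightSides M.1))) (DY1.V K)).hom ≫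
  (DY1.Bpow K m ◁ DY1.actIter K (count (rightSides M.1)))

end Morphism

end DrinfeldYetter

/-! The Drinfeld–Yetter relation rewrites one action followed by one coaction as three terms in
which the coaction comes first: the two strands cross, or the action strand and the new coaction
strand are merged by the bracket, or the action strand is split by the cobracket, with sign -1. In
`π^{(n)} ; π^{*(m)}` every action has to be moved past every coaction. This gives a grid with one
row per action and one column per coaction, and each choice of term is a tile: the left side of a
cell is the arriving action, its top side the coaction to be passed, its right side the action still
to be carried on, its bottom side the coaction that now happens earlier.

A bracket leaves no action to carry further and a cobracket leaves no earlier coaction, so later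
cells may lack one of the two strands. If the missing (co)action is read as that of the unit object,
the relation extends to all four cases (`actStrand_coactStrand`): `actStrand l ≫ coactStrand t` is
the signed sum over all tiles with left side `l` and top side `t`. The degenerate cases each have
exactly one tile (action, coaction or empty) and hold by coherence. Apart from the symmetric
monoidal structure, this relation is all that enters.

The rest is a double induction. Iterating along a row, the right side of each tile being the left
side of the next, gives `actStrand_coactStrands`; iterating over the rows, the bottom sides of a row
being the top sides of the next, gives `actIter_coactStrands`. The matching conditions of a mosaic
are exactly the indexing conditions of these nested sums, and the boundary conditions say that all
original actions and coactions are present. That the composite of the local terms is the morphism of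
the whole mosaic, with all coactions first and all actions last, is the interchange law
(`sandwich_horizontal`, `sandwich_vertical`). Finally, the sequences of sides with gaps used in the
induction are identified with the powers `[k]` that occur in `Mosaic.phi`. -/

namespace DrinfeldYetter

/-! ### Interchange laws in a general monoidal category -/

section Coherence

variable {C : Type*} [Category C] [MonoidalCategory C]

/-- The morphism `X ⊗ W ⟶ Y ⊗ W` obtained from `f : X ⊗ P ⟶ Y ⊗ Q` by letting `W` create the
input `P` and absorb the output `Q`. -/
def sandwich {X P Y Q W : C} (c : W ⟶ P ⊗ W) (f : X ⊗ P ⟶ Y ⊗ Q) (a : Q ⊗ W ⟶ W) :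
    X ⊗ W ⟶ Y ⊗ W :=
  X ◁ c ≫ (α_ X P W).inv ≫ f ▷ W ≫ (α_ Y Q W).hom ≫ Y ◁ a

/-- The second coaction `c'` touches only `W` and the left block `f` does not touch `W`, so the
interchange law lets `f` be applied before `c'`. What remains is coherence. This is what peels the
first tile off a row. -/
theorem sandwich_horizontal {L P P' T R T' R' W : C} (c : W ⟶ P ⊗ W) (c' : W ⟶ P' ⊗ W)
    (f : L ⊗ P ⟶ T ⊗ R) (g : R ⊗ P' ⟶ T' ⊗ R') (a : R' ⊗ W ⟶ W) :
    sandwich (c ≫ P ◁ c' ≫ (α_ P P' W).inv)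
        ((α_ L P P').inv ≫ f ▷ P' ≫ (α_ T R P').hom ≫ T ◁ g ≫ (α_ T T' R').inv) a =
      (L ◁ c ≫ (α_ L P W).inv ≫ f ▷ W ≫ (α_ T R W).hom) ≫ T ◁ sandwich c' g a ≫
        (α_ T T' W).inv := by
  have h : f ▷ W ≫ (T ⊗ R) ◁ c' = (L ⊗ P) ◁ c' ≫ f ▷ (P' ⊗ W) := (whisker_exchange _ _).symm
  simp only [sandwich, MonoidalCategory.whiskerLeft_comp, comp_whiskerRight, Category.assoc]
  have h' : (α_ T R W).hom ≫ T ◁ R ◁ c' = (T ⊗ R) ◁ c' ≫ (α_ T R (P' ⊗ W)).hom := by simp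
  rw [reassoc_of% h', reassoc_of% h]
  monoidal

/-- The action `a'` of the lower block's right side and the upper block `g` involve disjoint
strands, so `a'` can be performed before `g`; the lower block is then a complete sandwich. This is
what peels the first row off a tiling. -/
theorem sandwich_vertical {L N P B R R' T W : C} (c : W ⟶ P ⊗ W)
    (f : N ⊗ P ⟶ B ⊗ R') (g : L ⊗ B ⟶ T ⊗ R) (a : R ⊗ W ⟶ W) (a' : R' ⊗ W ⟶ W) :
    sandwich c
        ((α_ L N P).hom ≫ L ◁ f ≫ (α_ L B R').inv ≫ g ▷ R' ≫ (α_ T R R').hom)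
        ((α_ R R' W).hom ≫ R ◁ a' ≫ a) =
      (α_ L N W).hom ≫ L ◁ sandwich c f a' ≫ (α_ L B W).inv ≫ g ▷ W ≫ (α_ T R W).hom ≫
        T ◁ a := by
  have h : (L ⊗ B) ◁ a' ≫ g ▷ W = g ▷ (R' ⊗ W) ≫ (T ⊗ R) ◁ a' := whisker_exchange _ _
  simp only [sandwich, MonoidalCategory.whiskerLeft_comp, comp_whiskerRight, Category.assoc]
  have h' : L ◁ B ◁ a' ≫ (α_ L B W).inv = (α_ L B (R' ⊗ W)).inv ≫ (L ⊗ B) ◁ a' := by simp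
  rw [reassoc_of% h', reassoc_of% h]
  monoidal

/-- Changes of the inner objects can be absorbed into the coaction and the action, while a change of
the output slides past the action. It serves to dispose of the transports in `Mosaic.phi`. -/
theorem sandwich_comp {X P P' Y Y' Q Q' W : C} (c : W ⟶ P' ⊗ W) (e : P' ⟶ P)
    (f : X ⊗ P ⟶ Y ⊗ Q) (u : Y ⟶ Y') (e' : Q ⟶ Q') (a : Q' ⊗ W ⟶ W) :
    sandwich c ((X ◁ e) ≫ f ≫ (u ⊗ₘ e')) a =
      sandwich (c ≫ e ▷ W) f (e' ▷ W ≫ a) ≫ u ▷ W := by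
  have h : Y ◁ a ≫ u ▷ W = u ▷ (Q' ⊗ W) ≫ Y' ◁ a := whisker_exchange _ _
  simp only [sandwich, tensorHom_def', MonoidalCategory.whiskerLeft_comp, comp_whiskerRight,
    Category.assoc, h]
  monoidal

end Coherence

/-- The explicit enumeration lets `decide` list the tiles with given left and top sides. -/
instance : Fintype Tile :=
  ⟨{.permutation, .bracket, .cobracket, .action, .coaction, .empty}, by intro t; cases t <;> simp⟩

/-! ### The local relation: one action against one coaction -/

section Expansion

variable (K : Type u) [Field K]

open DY1

/-- The action of a side that may or may not carry a strand. -/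
def actStrand : (l : Bool) → (strand K l ⊗ V K ⟶ V K)
  | true => act K
  | false => (λ_ (V K)).hom

/-- The coaction creating a side that may or may not carry a strand. -/
def coactStrand : (t : Bool) → (V K ⟶ strand K t ⊗ V K)
  | true => coact K
  | false => (λ_ (V K)).inv

/-- The iterated action of a sequence of sides. -/
def actStrands : {k : ℕ} → (p : Fin k → Bool) → (strands K p ⊗ V K ⟶ V K)
  | 0, _ => (λ_ (V K)).hom
  | _ + 1, p => (α_ (strand K (p 0)) (strands K fun j => p j.succ) (V K)).hom ≫
      (strand K (p 0) ◁ actStrands fun j => p j.succ) ≫ actStrand K (p 0)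

/-- The iterated coaction creating a sequence of sides. -/
def coactStrands : {k : ℕ} → (p : Fin k → Bool) → (V K ⟶ strands K p ⊗ V K)
  | 0, _ => (λ_ (V K)).inv
  | _ + 1, p => coactStrand K (p 0) ≫ (strand K (p 0) ◁ coactStrands fun j => p j.succ) ≫
      (α_ (strand K (p 0)) (strands K fun j => p j.succ) (V K)).inv

/-- The sign of a tile. -/
def Tile.sign (t : Tile) : K := if t = .cobracket then -1 else 1

/-- This is the defining Drinfeld–Yetter relation with the associators put back in; by strictness
they are identities. -/
theorem act_coact :
    act K ≫ coact K =
      sandwich (coact K) (β_ (B K) (B K)).hom (act K) +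
      (B K ◁ coact K ≫ (α_ (B K) (B K) (V K)).inv ≫ mu K ▷ V K) -
      (delta K ▷ V K ≫ (α_ (B K) (B K) (V K)).hom ≫ B K ◁ act K) := by
  -- The two bracketings of the triple product are the same word by definition, so the whiskered
  -- action and coaction can be retyped without an associator.
  let x : (B K ⊗ B K) ⊗ V K ⟶ B K ⊗ V K := (B K ◁ act K :)
  let y : B K ⊗ V K ⟶ (B K ⊗ B K) ⊗ V K := (B K ◁ coact K :)
  have hx : (α_ (B K) (B K) (V K)).hom ≫ B K ◁ act K = x := Category.id_comp _
  have hy : B K ◁ coact K ≫ (α_ (B K) (B K) (V K)).inv = y := Category.comp_id _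
  have key : act K ≫ coact K =
      y ≫ (((β_ (B K) (B K)).hom ▷ V K ≫ x) + mu K ▷ V K) + (-1 : K) • (delta K ▷ V K ≫ x) :=
    homMk_eq Rel.drinfeldYetter
  -- From here on the retyped morphisms are opaque and the associators enter only through `hx` and
  -- `hy`.
  clear_value x y
  simp only [sandwich]
  rw [key, hx, reassoc_of% hy, reassoc_of% hy, neg_one_smul, Preadditive.comp_add, ← sub_eq_add_neg]

/-- A side coacts on `[V₁]`, and then a tile is applied to the resulting strand. -/
def tileHead {l t : Bool} (a : {a : Tile // l = a.left ∧ t = a.top}) :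
    strand K l ⊗ V K ⟶ strand K t ⊗ strand K a.1.right ⊗ V K :=
  (eqToHom (congrArg (strand K) a.2.1) ▷ V K) ≫
  (strand K a.1.left ◁ coactStrand K a.1.bottom) ≫
  (α_ (strand K a.1.left) (strand K a.1.bottom) (V K)).inv ≫
  (a.1.hom K ▷ V K) ≫
  (α_ (strand K a.1.top) (strand K a.1.right) (V K)).hom ≫
  (eqToHom (congrArg (strand K) a.2.2.symm) ▷ _)

/-- The Drinfeld-Yetter relation and its degenerate forms, in one formula. -/
theorem actStrand_coactStrand (l t : Bool) :
    actStrand K l ≫ coactStrand K t =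
      ∑ a : {a : Tile // l = a.left ∧ t = a.top}, a.1.sign K •
        (tileHead K a ≫ (strand K t ◁ actStrand K a.1.right)) := by
  -- The transport on the top strand commutes with the action of the right side. So the symmetric
  -- sandwich form proved below yields the form with the action last, ready to meet the next
  -- coaction of the row.
  have hex (a : {a : Tile // l = a.left ∧ t = a.top}) :
      (strand K a.1.top ◁ actStrand K a.1.right) ≫
        (eqToHom (congrArg (strand K) a.2.2.symm) ▷ V K) =
        (eqToHom (congrArg (strand K) a.2.2.symm) ▷ _) ≫
          (strand K t ◁ actStrand K a.1.right) := whisker_exchange _ _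
  suffices h : actStrand K l ≫ coactStrand K t =
      ∑ a : {a : Tile // l = a.left ∧ t = a.top}, a.1.sign K •
        ((eqToHom (congrArg (strand K) a.2.1) ▷ V K) ≫
          sandwich (coactStrand K a.1.bottom) (a.1.hom K) (actStrand K a.1.right) ≫
          (eqToHom (congrArg (strand K) a.2.2.symm) ▷ V K)) by
    simpa only [sandwich, tileHead, Category.assoc, hex] using h
  -- Only the case where both strands are present uses the Drinfeld–Yetter relation. In the other
  -- three a single tile fits, and the identity involves only unitors.
  cases l <;> cases t
  · have hu : (Finset.univ : Finset {a : Tile // false = a.left ∧ false = a.top}) =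
        {⟨.empty, rfl, rfl⟩} := by decide
    rw [hu, Finset.sum_singleton]
    -- For concrete sides the transports are along reflexivity and unfold to identities; the same
    -- holds in the other cases.
    change (λ_ (V K)).hom ≫ (λ_ (V K)).inv = Tile.sign K .empty • ((𝟙 (𝟙_ (DY1 K)) ▷ V K) ≫ sandwich ((λ_ (V K)).inv) (𝟙 (𝟙_ (DY1 K) ⊗ 𝟙_ (DY1 K))) ((λ_ (V K)).hom) ≫
      (𝟙 (𝟙_ (DY1 K)) ▷ V K))
    simp [sandwich, Tile.sign]
  · have hu : (Finset.univ : Finset {a : Tile // false = a.left ∧ true = a.top}) =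
        {⟨.coaction, rfl, rfl⟩} := by decide
    rw [hu, Finset.sum_singleton]
    change (λ_ (V K)).hom ≫ coact K = Tile.sign K .coaction • ((𝟙 (𝟙_ (DY1 K)) ▷ V K) ≫ sandwich (coact K) ((λ_ (B K)).hom ≫ (ρ_ (B K)).inv) ((λ_ (V K)).hom) ≫
      (𝟙 (B K) ▷ V K))
    simp [sandwich, Tile.sign]
  · have hu : (Finset.univ : Finset {a : Tile // true = a.left ∧ false = a.top}) =
        {⟨.action, rfl, rfl⟩} := by decide
    rw [hu, Finset.sum_singleton]
    change act K ≫ (λ_ (V K)).inv = Tile.sign K .action • ((𝟙 (B K) ▷ V K) ≫ sandwich ((λ_ (V K)).inv) ((ρ_ (B K)).hom ≫ (λ_ (B K)).inv) (act K) ≫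
      (𝟙 (𝟙_ (DY1 K)) ▷ V K))
    simp [sandwich, Tile.sign]
  · have hu : (Finset.univ : Finset {a : Tile // true = a.left ∧ true = a.top}) =
        {⟨.permutation, rfl, rfl⟩, ⟨.bracket, rfl, rfl⟩, ⟨.cobracket, rfl, rfl⟩} := by decide
    rw [hu, Finset.sum_insert (by decide), Finset.sum_insert (by decide), Finset.sum_singleton]
    change act K ≫ coact K = Tile.sign K .permutation • ((𝟙 (B K) ▷ V K) ≫ sandwich (coact K) ((β_ (B K) (B K)).hom) (act K) ≫
      (𝟙 (B K) ▷ V K)) + (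
      Tile.sign K .bracket • ((𝟙 (B K) ▷ V K) ≫ sandwich (coact K) (mu K ≫ (ρ_ (B K)).inv) ((λ_ (V K)).hom) ≫
      (𝟙 (B K) ▷ V K)) +
      Tile.sign K .cobracket • ((𝟙 (B K) ▷ V K) ≫ sandwich ((λ_ (V K)).inv) ((ρ_ (B K)).hom ≫ delta K) (act K) ≫
      (𝟙 (B K) ▷ V K)))
    rw [act_coact]
    simp [sandwich, Tile.sign]
    abel

/-! ### Rows and tilings: recursive decomposition -/

/-- The rows of tiles with left side `l` and top sides `t` whose red lines match. -/
abbrev MatchingRow {m : ℕ} (l : Bool) (t : Fin m → Bool) : Type :=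
  {r : Fin m → Tile // RowMatches l r ∧ t = fun j => (r j).top}

/-- The tilings with top sides `t`, all of whose left sides carry a strand, whose red lines
match. -/
abbrev MatchingTiling (n : ℕ) {m : ℕ} (t : Fin m → Bool) : Type :=
  {M : Tiling n m // TilingMatches t M}

noncomputable instance {m : ℕ} (l : Bool) (t : Fin m → Bool) : Fintype (MatchingRow l t) := by
  classical exact Subtype.fintype _

noncomputable instance (n : ℕ) {m : ℕ} (t : Fin m → Bool) : Fintype (MatchingTiling n t) := by
  classical exact Subtype.fintype _

/-- A nonempty row consists of its first tile and of the row of the other tiles. -/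
def matchingRowEquiv {m : ℕ} (l : Bool) (t : Fin (m + 1) → Bool) :
    MatchingRow l t ≃
      Σ a : {a : Tile // l = a.left ∧ t 0 = a.top}, MatchingRow a.1.right fun j => t j.succ where
  toFun r := ⟨⟨r.1 0, r.2.1.1, congrFun r.2.2 0⟩,
    ⟨fun j => r.1 j.succ, r.2.1.2, funext fun j => congrFun r.2.2 j.succ⟩⟩
  invFun x := ⟨Fin.cons x.1.1 x.2.1, ⟨x.1.2.1, x.2.2.1⟩,
    funext (Fin.cases x.1.2.2 (congrFun x.2.2.2))⟩
  left_inv r := Subtype.ext (Fin.cons_self_tail r.1)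
  right_inv _ := rfl

/-- A nonempty tiling consists of its first row and of the tiling by the other rows. -/
def matchingTilingEquiv (n : ℕ) {m : ℕ} (t : Fin m → Bool) :
    MatchingTiling (n + 1) t ≃
      Σ r : MatchingRow true t, MatchingTiling n fun j => (r.1 j).bottom where
  toFun M := ⟨⟨M.1 0, M.2.1, M.2.2.1⟩, ⟨fun i => M.1 i.succ, M.2.2.2⟩⟩
  invFun x := ⟨Fin.cons x.1.1 x.2.1, x.1.2.1, x.1.2.2, x.2.2⟩
  left_inv M := Subtype.ext (Fin.cons_self_tail M.1)
  right_inv _ := rfl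

/-- The sign of a row of tiles. -/
def rowSign {m : ℕ} (r : Fin m → Tile) : K := ∏ j, (r j).sign K

/-- The sign of a tiling. -/
def tilingSign {n m : ℕ} (M : Tiling n m) : K := ∏ i, rowSign K (M i)

/-- The morphism `l ⊗ [V₁] ⟶ t ⊗ [V₁]` read off a row of tiles. -/
def rowPhi {m : ℕ} {l : Bool} {t : Fin m → Bool} (r : MatchingRow l t) :
    strand K l ⊗ V K ⟶ strands K t ⊗ V K :=
  sandwich (coactStrands K fun j => (r.1 j).bottom)
    (rowHom K l r.1 r.2.1 ≫ (eqToHom (congrArg (strands K) r.2.2.symm) ▷ _))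
    (actStrand K (rowRight l r.1))

/-- The morphism `[n] ⊗ [V₁] ⟶ t ⊗ [V₁]` read off a tiling. -/
def tilingPhi {n m : ℕ} {t : Fin m → Bool} (M : MatchingTiling n t) :
    Bpow K n ⊗ V K ⟶ strands K t ⊗ V K :=
  sandwich (coactStrands K (bottomSides t M.1)) (tilingHom K t M.1 M.2)
    (actStrands K (rightSides M.1))

/-- By `sandwich_horizontal`, the morphism of a row begins with its first tile, whose right strand
then enters the rest of the row. This matches the recursion used to expand an action against several
coactions. -/
theorem rowPhi_succ {m : ℕ} {l : Bool} {t : Fin (m + 1) → Bool} (r : MatchingRow l t) :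
    rowPhi K r =
      tileHead K (matchingRowEquiv l t r).1 ≫
      (strand K (t 0) ◁ rowPhi K (matchingRowEquiv l t r).2) ≫
      (α_ (strand K (t 0)) (strands K fun j => t j.succ) (V K)).inv := by
  obtain ⟨r, ⟨h, h'⟩, rfl⟩ := r
  -- Now `l` and `t` are literally the sides of `r`, so every transport is an identity and the
  -- general interchange law applies.
  subst h
  have key := sandwich_horizontal (coactStrand K (r 0).bottom)
    (coactStrands K fun j : Fin m => (r j.succ).bottom) ((r 0).hom K)
    (rowHom K (r 0).right (fun j => r j.succ) h')
    (actStrand K (rowRight (r 0).right fun j => r j.succ))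
  have h₁ : tileHead K (l := (r 0).left) (t := (r 0).top) ⟨r 0, rfl, rfl⟩ =
      (strand K (r 0).left ◁ coactStrand K (r 0).bottom) ≫ (α_ _ _ _).inv ≫
        ((r 0).hom K ▷ V K) ≫ (α_ (strand K (r 0).top) (strand K (r 0).right) (V K)).hom := by
    simp [tileHead]
  have h₂ : rowPhi K (l := (r 0).right) (t := fun j : Fin m => (r j.succ).top)
      ⟨fun j => r j.succ, h', rfl⟩ =
      sandwich (coactStrands K fun j : Fin m => (r j.succ).bottom)
        (rowHom K (r 0).right (fun j => r j.succ) h')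
        (actStrand K (rowRight (r 0).right fun j => r j.succ)) := by
    simp [rowPhi]
  refine Eq.trans ?_ (key.trans (congrArg₂ (fun f g => f ≫
    (strand K (r 0).top ◁ g) ≫ (α_ (strand K (r 0).top)
      (strands K fun j => (r j.succ).top) (V K)).inv) h₁.symm h₂.symm))
  change sandwich _ (((𝟙 _ ▷ _) ≫ _) ≫ (𝟙 _ ▷ _)) _ = _
  simp only [id_whiskerRight, Category.id_comp]
  exact congrArg (fun f => sandwich _ f _) (Category.comp_id _)

/-- A row of tiles is applied, and then its right side acts on `[V₁]`. -/
def rowTail {m : ℕ} {t : Fin m → Bool} (r : MatchingRow true t) :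
    B K ⊗ (strands K fun j => (r.1 j).bottom) ⊗ V K ⟶ strands K t ⊗ V K :=
  (α_ (B K) (strands K fun j => (r.1 j).bottom) (V K)).inv ≫
  ((rowHom K true r.1 r.2.1 ≫ (eqToHom (congrArg (strands K) r.2.2.symm) ▷ _)) ▷ V K) ≫
  (α_ (strands K t) (strand K (rowRight true r.1)) (V K)).hom ≫
  (strands K t ◁ actStrand K (rowRight true r.1))

/-- By `sandwich_vertical`, the rows below can be completed, including their actions on `[V₁]`,
before the first row is applied. The first row comes last because its strand is the last to act in
`actIter`. -/
theorem tilingPhi_succ {n m : ℕ} {t : Fin m → Bool} (M : MatchingTiling (n + 1) t) :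
    tilingPhi K M =
      (α_ (B K) (Bpow K n) (V K)).hom ≫ (B K ◁ tilingPhi K (matchingTilingEquiv n t M).2) ≫
        rowTail K (matchingTilingEquiv n t M).1 := by
  obtain ⟨M, hr, rfl, h⟩ := M
  have key := sandwich_vertical (coactStrands K (bottomSides (fun j => (M 0 j).bottom)
      fun i => M i.succ))
    (tilingHom K (fun j => (M 0 j).bottom) (fun i => M i.succ) h) (rowHom K true (M 0) hr)
    (actStrand K (rowRight true (M 0))) (actStrands K (rightSides fun i => M i.succ))
  refine Eq.trans (congrArg (fun f => sandwich _ f _) ?_) (key.trans ?_)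
  · change _ ≫ _ ≫ _ ≫ _ ≫ _ ≫ (𝟙 _ ▷ _) = _
    simp only [id_whiskerRight, Category.comp_id]
    rfl
  · change _ = _ ≫ _ ≫ _ ≫ ((_ ≫ (𝟙 _ ▷ _)) ▷ _) ≫ _ ≫ _
    rw [id_whiskerRight]
    exact congrArg (fun f => _ ≫ _ ≫ _ ≫ (f ▷ _) ≫ _ ≫ _) (Category.comp_id _).symm

theorem rowSign_symm {m : ℕ} (l : Bool) (t : Fin (m + 1) → Bool)
    (a : {a : Tile // l = a.left ∧ t 0 = a.top}) (r : MatchingRow a.1.right fun j => t j.succ) :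
    rowSign K ((matchingRowEquiv l t).symm ⟨a, r⟩).1 = a.1.sign K * rowSign K r.1 :=
  Fin.prod_univ_succ _

theorem tilingSign_symm (n : ℕ) {m : ℕ} (t : Fin m → Bool)
    (r : MatchingRow true t) (M : MatchingTiling n fun j => (r.1 j).bottom) :
    tilingSign K ((matchingTilingEquiv n t).symm ⟨r, M⟩).1 = rowSign K r.1 * tilingSign K M.1 :=
  Fin.prod_univ_succ _

/-! ### The expansion over rows and over tilings -/

/-- One side acts and a sequence of sides coacts: the expansion over rows of tiles. -/
theorem actStrand_coactStrands {m : ℕ} (l : Bool) (t : Fin m → Bool) :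
    actStrand K l ≫ coactStrands K t = ∑ r : MatchingRow l t, rowSign K r.1 • rowPhi K r := by
  induction m generalizing l with
  | zero =>
    have ht : t = fun j : Fin 0 => (Fin.elim0 j : Tile).top := funext fun j => j.elim0
    let r : MatchingRow l t := ⟨fun j => j.elim0, trivial, ht⟩
    rw [Fintype.sum_eq_single r fun r' h => (h (Subtype.ext (Subsingleton.elim _ _))).elim]
    have hs : rowSign K r.1 = 1 := Fin.prod_univ_zero _
    rw [hs, one_smul]
    change actStrand K l ≫ (λ_ (V K)).inv =
      sandwich (λ_ (V K)).inv
        (((ρ_ (strand K l)).hom ≫ (λ_ (strand K l)).inv) ≫ (𝟙 (𝟙_ (DY1 K)) ▷ _)) (actStrand K l)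
    simp [sandwich]
  | succ m ih =>
    rw [← (matchingRowEquiv l t).symm.sum_comp, Fintype.sum_sigma]
    change actStrand K l ≫ coactStrand K (t 0) ≫
      (strand K (t 0) ◁ coactStrands K fun j => t j.succ) ≫ (α_ _ _ _).inv = _
    -- The first cell is expanded; what follows its head is the action of its right side against the
    -- remaining coactions. The induction hypothesis is therefore needed for an arbitrary left side.
    rw [← Category.assoc, actStrand_coactStrand, Preadditive.sum_comp]
    refine Finset.sum_congr rfl fun a _ => ?_
    have hr (r : MatchingRow a.1.right fun j => t j.succ) :
        rowSign K ((matchingRowEquiv l t).symm ⟨a, r⟩).1 •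
          rowPhi K ((matchingRowEquiv l t).symm ⟨a, r⟩) =
        (a.1.sign K * rowSign K r.1) • (tileHead K a ≫ (strand K (t 0) ◁ rowPhi K r) ≫
          (α_ (strand K (t 0)) (strands K fun j => t j.succ) (V K)).inv) := by
      rw [rowSign_symm, rowPhi_succ, Equiv.apply_symm_apply]
      rfl
    simp only [hr]
    rw [Linear.smul_comp, Category.assoc, ← MonoidalCategory.whiskerLeft_comp_assoc, ih]
    simp only [whiskerLeft_sum, Preadditive.sum_comp, Preadditive.comp_sum, Finset.smul_sum,
      MonoidalLinear.whiskerLeft_smul, Linear.smul_comp, Linear.comp_smul, mul_smul]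
    rfl

/-- Induction on the number of actions. The last action is moved through all coactions by the row
expansion, and the remaining ones then meet the coactions at the bottom sides of that row. Since
some of these may be missing, the top sides `t` have to be arbitrary. -/
theorem actIter_coactStrands {m : ℕ} (n : ℕ) (t : Fin m → Bool) :
    actIter K n ≫ coactStrands K t =
      ∑ M : MatchingTiling n t, tilingSign K M.1 • tilingPhi K M := by
  induction n generalizing t with
  | zero =>
    let M : MatchingTiling 0 t := ⟨fun i => i.elim0, trivial⟩
    rw [Fintype.sum_eq_single M fun M' h => (h (Subtype.ext (Subsingleton.elim _ _))).elim]
    have hs : tilingSign K M.1 = 1 := Fin.prod_univ_zero _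
    rw [hs, one_smul]
    change (λ_ (V K)).hom ≫ coactStrands K t =
      sandwich (coactStrands K t) ((λ_ (strands K t)).hom ≫ (ρ_ (strands K t)).inv) (λ_ (V K)).hom
    simp [sandwich]
  | succ n ih =>
    rw [← (matchingTilingEquiv n t).symm.sum_comp, Fintype.sum_sigma]
    -- `rowPhi` is by definition the coactions of the bottom sides followed by `rowTail`; this
    -- splitting lets the remaining actions meet these coactions.
    have hrow : act K ≫ coactStrands K t = ∑ r : MatchingRow true t, rowSign K r.1 •
        ((B K ◁ coactStrands K fun j => (r.1 j).bottom) ≫ rowTail K r) :=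
      actStrand_coactStrands K true t
    have h : ((α_ (B K) (Bpow K n) (V K)).hom ≫ (B K ◁ actIter K n) ≫ act K) ≫
        coactStrands K t = ∑ r : MatchingRow true t,
          ∑ M : MatchingTiling n fun j => (r.1 j).bottom, (rowSign K r.1 * tilingSign K M.1) •
            ((α_ (B K) (Bpow K n) (V K)).hom ≫ (B K ◁ tilingPhi K M) ≫ rowTail K r) := by
      simp only [Category.assoc, hrow, Preadditive.comp_sum, Linear.comp_smul]
      refine Finset.sum_congr rfl fun r _ => ?_
      rw [← MonoidalCategory.whiskerLeft_comp_assoc, ih]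
      simp only [whiskerLeft_sum, Preadditive.sum_comp, Preadditive.comp_sum, Finset.smul_sum,
        MonoidalLinear.whiskerLeft_smul, Linear.smul_comp, Linear.comp_smul, mul_smul]
    refine h.trans (Finset.sum_congr rfl fun r _ => Finset.sum_congr rfl fun M _ => ?_)
    rw [tilingSign_symm, tilingPhi_succ, Equiv.apply_symm_apply]
    rfl

/-! ### Sequences of sides with gaps versus powers of `[1]` -/

theorem count_cons {k : ℕ} (b : Bool) (p : Fin k → Bool) :
    count (Fin.cons b p : Fin (k + 1) → Bool) = if b = true then count p + 1 else count p :=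
  Fin.card_filter_univ_succ _

theorem eqToHom_unit_tensor {X Y : DY1 K} (h : 𝟙_ (DY1 K) ⊗ X = Y) (h' : X = Y) :
    eqToHom h = (λ_ X).hom ≫ eqToHom h' := by
  rw [leftUnitor_hom, eqToHom_trans]

/-- A side without a strand contributes a unit object and a trivial coaction, so by strictness only
the strands that are present count. Leaving `c` free up to `hc` lets the induction replace it by the
value of the count in each case, instead of rewriting inside dependent types. -/
theorem coactStrands_comp_eqToHom {k : ℕ} (p : Fin k → Bool) {c : ℕ} (hc : count p = c)
    (h : strands K p = Bpow K c) :
    coactStrands K p ≫ (eqToHom h ▷ V K) = coactIter K c := by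
  induction k generalizing c with
  | zero =>
    obtain rfl : 0 = c := hc
    change (λ_ (V K)).inv ≫ (𝟙 (𝟙_ (DY1 K)) ▷ V K) = (λ_ (V K)).inv
    simp
  | succ k ih =>
    -- Written as a `Fin.cons`, the sequence has a head and a tail that compute, so the recursive
    -- definitions unfold by `change` once `b` is known.
    obtain ⟨b, p, rfl⟩ : ∃ b q, p = Fin.cons b q := ⟨p 0, Fin.tail p, (Fin.cons_self_tail p).symm⟩
    rw [count_cons] at hc
    cases b with
    | false =>
      obtain rfl : count p = c := hc
      have h₀ : 𝟙_ (DY1 K) ⊗ strands K p = Bpow K (count p) := h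
      have h' := strands_eq_Bpow K p
      change ((λ_ (V K)).inv ≫ (𝟙_ (DY1 K) ◁ coactStrands K p) ≫
        (α_ (𝟙_ (DY1 K)) (strands K p) (V K)).inv) ≫
        (eqToHom h₀ ▷ V K) = _
      rw [eqToHom_unit_tensor K _ h', ← ih p rfl h']
      -- Only naturality of the structural isomorphisms is needed, so the transport may be any
      -- morphism.
      generalize eqToHom h' = e
      simp
    | true =>
      obtain rfl : count p + 1 = c := hc
      have h₀ : B K ⊗ strands K p = B K ⊗ Bpow K (count p) := h
      have h' := strands_eq_Bpow K p
      change (coact K ≫ (B K ◁ coactStrands K p) ≫ (α_ (B K) (strands K p) (V K)).inv) ≫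
        (eqToHom h₀ ▷ V K) =
        coact K ≫ (B K ◁ coactIter K (count p)) ≫ (α_ (B K) (Bpow K (count p)) (V K)).inv
      rw [← whiskerLeft_eqToHom (B K) h', ← ih p rfl h']
      generalize eqToHom h' = e
      simp

/-- The dual of `coactStrands_comp_eqToHom`: a gap acts through the left unitor and is invisible to
the iterated action. -/
theorem eqToHom_comp_actIter {k : ℕ} (p : Fin k → Bool) {c : ℕ} (hc : count p = c)
    (h : strands K p = Bpow K c) :
    (eqToHom h ▷ V K) ≫ actIter K c = actStrands K p := by
  induction k generalizing c with
  | zero =>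
    obtain rfl : 0 = c := hc
    change (𝟙 (𝟙_ (DY1 K)) ▷ V K) ≫ (λ_ (V K)).hom = (λ_ (V K)).hom
    simp
  | succ k ih =>
    obtain ⟨b, p, rfl⟩ : ∃ b q, p = Fin.cons b q := ⟨p 0, Fin.tail p, (Fin.cons_self_tail p).symm⟩
    rw [count_cons] at hc
    cases b with
    | false =>
      obtain rfl : count p = c := hc
      have h₀ : 𝟙_ (DY1 K) ⊗ strands K p = Bpow K (count p) := h
      have h' := strands_eq_Bpow K p
      change (eqToHom h₀ ▷ V K) ≫ _ =
        (α_ (𝟙_ (DY1 K)) (strands K p) (V K)).hom ≫ (𝟙_ (DY1 K) ◁ actStrands K p) ≫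
          (λ_ (V K)).hom
      rw [eqToHom_unit_tensor K _ h', ← ih p rfl h']
      generalize eqToHom h' = e
      simp
    | true =>
      obtain rfl : count p + 1 = c := hc
      have h₀ : B K ⊗ strands K p = B K ⊗ Bpow K (count p) := h
      have h' := strands_eq_Bpow K p
      change (eqToHom h₀ ▷ V K) ≫
        (α_ (B K) (Bpow K (count p)) (V K)).hom ≫ (B K ◁ actIter K (count p)) ≫ act K =
        (α_ (B K) (strands K p) (V K)).hom ≫ (B K ◁ actStrands K p) ≫ act K
      rw [← whiskerLeft_eqToHom (B K) h', ← ih p rfl h']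
      generalize eqToHom h' = e
      simp

/-! ### Mosaics as tilings with matching red lines -/

theorem RowMatches.left_eq {m : ℕ} {l : Bool} {r : Fin m → Tile} (h : RowMatches l r) (j : Fin m)
    (hj : j.val = 0) : l = (r j).left := by
  cases m with
  | zero => exact j.elim0
  | succ m =>
    obtain rfl : j = 0 := Fin.ext hj
    exact h.1

theorem RowMatches.right_eq {m : ℕ} {l : Bool} {r : Fin m → Tile} (h : RowMatches l r)
    (j j' : Fin m) (hj : j'.val = j.val + 1) : (r j).right = (r j').left := by
  induction m generalizing l with
  | zero => exact j.elim0
  | succ m ih =>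
    obtain ⟨i', rfl⟩ := Fin.exists_succ_eq.2 (show j' ≠ 0 by rintro rfl; simp at hj)
    rw [Fin.val_succ, Nat.add_right_cancel_iff] at hj
    cases j using Fin.cases with
    | zero => exact h.2.left_eq i' hj
    | succ j => exact ih h.2 j i' hj

theorem TilingMatches.rowMatches {n m : ℕ} {t : Fin m → Bool} {M : Tiling n m}
    (h : TilingMatches t M) (i : Fin n) : RowMatches true (M i) := by
  induction n generalizing t with
  | zero => exact i.elim0
  | succ n ih =>
    cases i using Fin.cases with
    | zero => exact h.1
    | succ i => exact ih h.2.2 i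

theorem TilingMatches.top_eq {n m : ℕ} {t : Fin m → Bool} {M : Tiling n m}
    (h : TilingMatches t M) (i : Fin n) (j : Fin m) (hi : i.val = 0) : t j = (M i j).top := by
  cases n with
  | zero => exact i.elim0
  | succ n =>
    obtain rfl : i = 0 := Fin.ext hi
    exact congrFun h.2.1 j

theorem TilingMatches.bottom_eq {n m : ℕ} {t : Fin m → Bool} {M : Tiling n m}
    (h : TilingMatches t M) (i i' : Fin n) (j : Fin m) (hi : i'.val = i.val + 1) :
    (M i j).bottom = (M i' j).top := by
  induction n generalizing t with
  | zero => exact i.elim0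
  | succ n ih =>
    obtain ⟨k, rfl⟩ := Fin.exists_succ_eq.2 (show i' ≠ 0 by rintro rfl; simp at hi)
    rw [Fin.val_succ, Nat.add_right_cancel_iff] at hi
    cases i using Fin.cases with
    | zero => exact h.2.2.top_eq k j hi
    | succ i => exact ih h.2.2 i k hi

/-- The converse of `Mosaic.tilingMatches`: the recursive matching conditions, which index the
expansion, give back the local conditions on adjacent tiles and on the boundary. -/
theorem TilingMatches.isMosaic {n m : ℕ} {M : Tiling n m}
    (h : TilingMatches (fun _ => true) M) : IsMosaic M where
  firstRow i j hi := by
    have := h.top_eq i j hi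
    revert this
    cases M i j <;> simp [Tile.top]
  firstColumn i j hj := by
    have := (h.rowMatches i).left_eq j hj
    revert this
    cases M i j <;> simp [Tile.left]
  row i j j' hj := (Tile.notMem_forbiddenRow_iff _ _).2 ((h.rowMatches i).right_eq j j' hj)
  column i i' j hi := (Tile.notMem_forbiddenColumn_iff _ _).2 (h.bottom_eq i i' j hi)

/-- The mosaics are the tilings with matching red lines, all of whose top and left sides carry a
strand. -/
def mosaicEquiv (n m : ℕ) : Mosaic n m ≃ MatchingTiling n fun _ : Fin m => true where
  toFun M := ⟨M.1, M.tilingMatches⟩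
  invFun M := ⟨M.1, M.2.isMosaic⟩
  left_inv _ := rfl
  right_inv _ := rfl

theorem tilingSign_mosaicEquiv {n m : ℕ} (M : Mosaic n m) :
    tilingSign K (mosaicEquiv n m M).1 = (-1) ^ M.alpha := by
  change ∏ i, ∏ j, (if M.1 i j = Tile.cobracket then (-1 : K) else 1) = _
  rw [← Fintype.prod_prod_type', Mosaic.alpha, Finset.prod_ite, Finset.prod_const,
    Finset.prod_const_one, mul_one]

theorem strands_true_eq_Bpow (m : ℕ) : strands K (fun _ : Fin m => true) = Bpow K m := by
  rw [strands_eq_Bpow]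
  simp [count]

/-- `Mosaic.phi` is a sandwich whose middle morphism carries transports between sequences of sides
and powers of `[1]`. Those at the bottom and right sides are absorbed by the iterated coaction and
action; the one at the top sides remains as a final change of target. -/
theorem phi_eq_tilingPhi {n m : ℕ} (M : Mosaic n m) :
    M.phi K = tilingPhi K (mosaicEquiv n m M) ≫ (eqToHom (strands_true_eq_Bpow K m) ▷ V K) := by
  refine (sandwich_comp _ _ _ _ _ _).trans ?_
  have h₁ : coactIter K (count (bottomSides (fun _ => true) M.1)) ≫
      (eqToHom (strands_eq_Bpow K (bottomSides (fun _ => true) M.1)).symm ▷ V K) =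
      coactStrands K (bottomSides (fun _ => true) M.1) := by
    rw [← coactStrands_comp_eqToHom K _ rfl (strands_eq_Bpow K _)]
    simp
  rw [h₁, eqToHom_comp_actIter K _ rfl]
  rfl

end Expansion

end DrinfeldYetter

theorem proposition4p2 {K : Type u} [Field K] [CharZero K] (n m : ℕ) :
    DrinfeldYetter.DY1.actIter K n ≫ DrinfeldYetter.DY1.coactIter K m =
      ∑ M : DrinfeldYetter.Mosaic n m, ((-1 : K) ^ M.alpha) • M.phi K := by
  -- The `m` coactions are those of a sequence of sides without gaps, so the general expansion
  -- applies with all top sides present.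
  rw [← DrinfeldYetter.coactStrands_comp_eqToHom K (fun _ : Fin m => true) (by
    simp [DrinfeldYetter.count]) (DrinfeldYetter.strands_true_eq_Bpow K m), ← Category.assoc,
    DrinfeldYetter.actIter_coactStrands, ← (DrinfeldYetter.mosaicEquiv n m).sum_comp,
    Preadditive.sum_comp]
  refine Finset.sum_congr rfl fun M _ => ?_
  rw [DrinfeldYetter.tilingSign_mosaicEquiv, DrinfeldYetter.phi_eq_tilingPhi, Linear.smul_comp]
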